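/- Let $1\le p<\infty$, let $E$ be a (real) Banach lattice and let $X$ be a (real) Banach space. A sequence $(x_n)_n$ in $E$ is *weakly $p$-summable* if $\sum_n |x^*(x_n)|^p<\infty$ for every $x^*\in E^*$, and *disjoint* if $|x_m|\wedge|x_n|=0$ whenever $m\neq n$. Assume that at least one of the following holds: 1. $p\ge 2$ and the dual $E^*$ has cotype $p$, i.e. there is $C>0$ such that for all finite families $x_1^*,\dots,x_n^*\in E^*$, $$\Big(\sum_{k=1}^n\|x_k^*\|^p\Big)^{1/p}\le C\Big(\int_0^1\Big\|\sum_{k=1}^n r_k(t)x_k^*\Big\|^2dt\Big)^{1/2},$$ where $(r_k)_k$ is the sequence of Rademacher functions, $r_k(t)=\operatorname{sign}(\sin(2^k\pi t))$; 2. $E$ has the disjoint property of order $p$, i.e. every norm bounded disjoint sequence in $E$ is weakly $p$-summable. Then for every bounded linear operator $T\colon E\to X$ the following are equivalent: (a) $T$ is disjoint $p$-convergent, i.e. $\|T(x_n)\|\to 0$ for every disjoint weakly $p$-summable sequence $(x_n)_n$ in $E$. (b) $\|T(x_n)\|\to 0$ for every positive weakly $p$-summable sequence $(x_n)_n$ in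 $E$. (c) $q_T(x_n)\to 0$ for every positive weakly $p$-summable sequence $(x_n)_n$ in $E$, where $q_T(x)=\sup\{\|T(y)\| : y\in E,\ |y|\le |x|\}$ for $x\in E$. Here a sequence $(x_n)_n$ is called positive if $x_n\ge 0$ for every $n$. -/

import Mathlib

open Filter Topology

noncomputable section

/-- The `k`-th Rademacher function `r_k(t) = sign (sin (2 ^ k * π * t))`; used for `k ≥ 1`
and `t ∈ [0, 1]`. -/
def rademacher (k : ℕ) (t : ℝ) : ℝ :=
  Real.sign (Real.sin (2 ^ k * Real.pi * t))

/-- A normed space `X` has cotype `p`, where `2 ≤ p < ∞`: there is a constant `C > 0` such that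
`(∑ ‖x_k‖ ^ p) ^ (1/p) ≤ C * (∫₀¹ ‖∑ r_k(t) x_k‖ ^ 2 dt) ^ (1/2)` for all finite families
`x_1, …, x_n` in `X`. The vector called `x_{k+1}` in mathematical indexing is `x k`, `k : Fin n`. -/
def HasCotype (X : Type*) [NormedAddCommGroup X] [NormedSpace ℝ X] (p : ℝ) : Prop :=
  2 ≤ p ∧ ∃ C : ℝ, 0 < C ∧ ∀ (n : ℕ) (x : Fin n → X),
    (∑ k, ‖x k‖ ^ p) ^ (1 / p) ≤
      C * (∫ t in (0 : ℝ)..1, ‖∑ k : Fin n, rademacher ((k : ℕ) + 1) t • x k‖ ^ 2) ^ (1 / 2 : ℝ)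

/-- A sequence `x` is weakly `p`-summable if `∑ₙ |f (x n)| ^ p < ∞` for every `f` in the dual. -/
def WeaklyPSummable {X : Type*} [NormedAddCommGroup X] [NormedSpace ℝ X] (p : ℝ)
    (x : ℕ → X) : Prop :=
  ∀ f : StrongDual ℝ X, Summable fun n => |f (x n)| ^ p

/-- A sequence in a vector lattice is disjoint if `|x m| ⊓ |x n| = 0` whenever `m ≠ n`. -/
def DisjointSeq {E : Type*} [AddCommGroup E] [Lattice E] (x : ℕ → E) : Prop :=
  ∀ m n, m ≠ n → |x m| ⊓ |x n| = 0

/-- A Banach lattice has the disjoint property of order `p` if every norm bounded disjoint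
sequence in it is weakly `p`-summable. -/
def HasDisjointProperty (E : Type*) [NormedAddCommGroup E] [NormedSpace ℝ E] [Lattice E]
    (p : ℝ) : Prop :=
  ∀ x : ℕ → E, (∃ M : ℝ, ∀ n, ‖x n‖ ≤ M) → DisjointSeq x → WeaklyPSummable p x

/-- A bounded operator from a Banach lattice to a Banach space is disjoint `p`-convergent if it
maps disjoint weakly `p`-summable sequences to norm null sequences. -/
def DisjointPConvergent {E X : Type*} [NormedAddCommGroup E] [NormedSpace ℝ E] [Lattice E]
    [NormedAddCommGroup X] [NormedSpace ℝ X] (p : ℝ) (T : E →L[ℝ] X) : Prop :=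
  ∀ x : ℕ → E, DisjointSeq x → WeaklyPSummable p x → Tendsto (fun n => ‖T (x n)‖) atTop (𝓝 0)

/-- The lattice seminorm `q_T(x) = sup {‖T y‖ : |y| ≤ |x|}`. -/
def qSeminorm {E X : Type*} [NormedAddCommGroup E] [NormedSpace ℝ E] [Lattice E]
    [NormedAddCommGroup X] [NormedSpace ℝ X] (T : E →L[ℝ] X) (x : E) : ℝ :=
  sSup {r : ℝ | ∃ y : E, |y| ≤ |x| ∧ r = ‖T y‖}

/-- The supremum in the definition of `qSeminorm` is a genuine least upper bound. -/
theorem isLUB_qSeminorm {E X : Type*} [NormedAddCommGroup E] [NormedSpace ℝ E] [Lattice E]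
    [HasSolidNorm E] [NormedAddCommGroup X] [NormedSpace ℝ X] (T : E →L[ℝ] X) (x : E) :
    IsLUB {r : ℝ | ∃ y : E, |y| ≤ |x| ∧ r = ‖T y‖} (qSeminorm T x) := by
  refine isLUB_csSup ⟨_, x, le_rfl, rfl⟩ ⟨‖T‖ * ‖x‖, ?_⟩
  rintro r ⟨y, hy, rfl⟩
  exact (T.le_opNorm y).trans
    (mul_le_mul_of_nonneg_left (HasSolidNorm.solid hy) (norm_nonneg T))

end

/-! The heart is (a) ⇒ (c), through a property of `q = qSeminorm T` in which `p` no longer appears.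
By (a) and the disjoint property, `q` tends to zero along bounded disjoint positive sequences
(`DisjointNull`). Every such seminorm tends to zero along positive weakly null sequences, in
particular along positive weakly `p`-summable ones.

For this, disjointification shows that a bounded set of positive elements is, up to `ε` in `q`,
below a single `u` (`exists_forall_posPart_sub_lt`), so only the truncations `x n ⊓ u` matter.
Disjointification also makes increasing order bounded sequences `q`-Cauchy, so the supremum of a
tail, which need not exist, can be replaced by a finite one. If `q (z n)` did not tend to zero for
truncations `z`, a positive functional below `q` attaining `q` at one term would be small on finite
suprema of much later terms, yet those almost dominate that term (`tendsto_zero_of_le`).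

Cotype of the dual implies the disjoint property: the norm of a disjoint sum is attained by
functionals whose sign combinations are uniformly bounded (`HasCotype.hasDisjointProperty`).
Finally, (c) ⇒ (b) is `‖T x‖ ≤ q x`, and (b) ⇒ (a) splits a disjoint sequence into positive and
negative parts. -/

set_option linter.unusedSectionVars false

/-! ### Inequalities and disjointness in vector lattices -/

section VectorLattice

variable {E : Type*} [AddCommGroup E] [Lattice E]

section IsOrderedAddMonoid

variable [IsOrderedAddMonoid E]

theorem inf_add_le_add_inf {a b c : E} (ha : 0 ≤ a) (hb : 0 ≤ b) (hc : 0 ≤ c) :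
    a ⊓ (b + c) ≤ a ⊓ b + a ⊓ c := by
  rw [inf_add, add_inf, add_inf]
  refine le_inf (le_inf ?_ ?_) (le_inf ?_ inf_le_right)
  · exact inf_le_left.trans (le_add_of_nonneg_left ha)
  · exact inf_le_left.trans (le_add_of_nonneg_right hc)
  · exact inf_le_left.trans (le_add_of_nonneg_left hb)

theorem inf_sum_le_sum_inf {ι : Type*} {a : E} (ha : 0 ≤ a) {b : ι → E} (hb : ∀ i, 0 ≤ b i)
    (s : Finset ι) : a ⊓ ∑ i ∈ s, b i ≤ ∑ i ∈ s, a ⊓ b i := by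
  classical
  induction s using Finset.induction_on with
  | empty => simp
  | insert i s hi ih =>
    rw [Finset.sum_insert hi, Finset.sum_insert hi]
    exact (inf_add_le_add_inf ha (hb i) (Finset.sum_nonneg fun j _ => hb j)).trans
      (add_le_add_right ih _)

/-- Since `a + b = a ⊓ b + a ⊔ b`, a sum of disjoint positive elements is their supremum. -/
theorem sum_le_of_disjoint {ι : Type*} {b : ι → E} (hb : ∀ i, 0 ≤ b i)
    (hd : ∀ i j, i ≠ j → b i ⊓ b j = 0) {w : E} (hw : 0 ≤ w) (h : ∀ i, b i ≤ w) (s : Finset ι) :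
    ∑ i ∈ s, b i ≤ w := by
  classical
  induction s using Finset.induction_on with
  | empty => simpa using hw
  | insert i s hi ih =>
    have h0 : b i ⊓ ∑ j ∈ s, b j = 0 := by
      refine le_antisymm ((inf_sum_le_sum_inf (hb i) hb s).trans ?_)
        (le_inf (hb i) (Finset.sum_nonneg fun j _ => hb j))
      refine (Finset.sum_eq_zero fun j hj => hd i j ?_).le
      rintro rfl
      exact hi hj
    rw [Finset.sum_insert hi, ← inf_add_sup, h0, zero_add]
    exact sup_le (h i) ih

theorem abs_le_abs_add_of_disjoint {a b : E} (h : |a| ⊓ |b| = 0) : |a| ≤ |a + b| := by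
  have h1 : |a| ≤ |a + b| + |b| := by
    simpa using abs_add_le (a + b) (-b)
  calc |a| = |a| ⊓ (|a + b| + |b|) := (inf_eq_left.2 h1).symm
    _ ≤ |a| ⊓ |a + b| + |a| ⊓ |b| :=
      inf_add_le_add_inf (abs_nonneg _) (abs_nonneg _) (abs_nonneg _)
    _ ≤ |a + b| := by rw [h, add_zero]; exact inf_le_right

theorem abs_finset_sum_le {ι : Type*} (z : ι → E) (s : Finset ι) :
    |∑ i ∈ s, z i| ≤ ∑ i ∈ s, |z i| :=
  Finset.le_sum_of_subadditive _ abs_zero.le abs_add_le s z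

theorem sum_abs_le_abs_sum_of_disjoint {ι : Type*} {z : ι → E}
    (hd : ∀ i j, i ≠ j → |z i| ⊓ |z j| = 0) (s : Finset ι) :
    ∑ i ∈ s, |z i| ≤ |∑ i ∈ s, z i| := by
  classical
  rw [← Finset.sum_coe_sort s fun i => |z i|]
  refine sum_le_of_disjoint (ι := s) (b := fun i => |z i|) (fun i => abs_nonneg _)
    (fun i j hij => hd i j fun h => hij (Subtype.ext h)) (abs_nonneg _) (fun i => ?_) _
  rw [← Finset.add_sum_erase s z i.2]
  refine abs_le_abs_add_of_disjoint (le_antisymm ?_ (le_inf (abs_nonneg _) (abs_nonneg _)))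
  calc |z i| ⊓ |∑ j ∈ s.erase i, z j| ≤ |z i| ⊓ ∑ j ∈ s.erase i, |z j| :=
        inf_le_inf_left _ (abs_finset_sum_le _ _)
    _ ≤ ∑ j ∈ s.erase i, |z i| ⊓ |z j| :=
        inf_sum_le_sum_inf (abs_nonneg _) (fun j => abs_nonneg _) _
    _ ≤ 0 := (Finset.sum_eq_zero fun j hj => hd _ _ (Finset.ne_of_mem_erase hj).symm).le

theorem sub_inf_eq_posPart_sub (a b : E) : a - a ⊓ b = (a - b)⁺ := by
  rw [sub_inf, sub_self, sup_comm, posPart_def]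

theorem le_posPart_sub_add (a b : E) : a ≤ (a - b)⁺ + b := by
  simpa [sub_le_iff_le_add] using le_posPart (a - b)

end IsOrderedAddMonoid

variable [Module ℝ E] [IsOrderedModule ℝ E]

theorem smul_inf_of_nonneg {c : ℝ} (hc : 0 ≤ c) (a b : E) : c • (a ⊓ b) = c • a ⊓ c • b := by
  rcases hc.eq_or_lt with rfl | hc
  · simp
  · exact (OrderIso.smulRight hc).map_inf a b

theorem smul_sup_of_nonneg {c : ℝ} (hc : 0 ≤ c) (a b : E) : c • (a ⊔ b) = c • a ⊔ c • b := by
  rcases hc.eq_or_lt with rfl | hc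
  · simp
  · exact (OrderIso.smulRight hc).map_sup a b

theorem smul_posPart_of_nonneg {c : ℝ} (hc : 0 ≤ c) (a : E) : (c • a)⁺ = c • a⁺ := by
  rw [posPart_def, posPart_def, smul_sup_of_nonneg hc, smul_zero]

theorem abs_real_smul (c : ℝ) (a : E) : |c • a| = |c| • |a| := by
  have key : ∀ {c : ℝ}, 0 ≤ c → |c • a| = c • |a| := fun {c} hc => by
    rw [abs, abs, smul_sup_of_nonneg hc, smul_neg]
  rcases le_total 0 c with hc | hc
  · rw [key hc, abs_of_nonneg hc]
  · rw [← abs_neg, ← neg_smul, key (neg_nonneg.2 hc), abs_of_nonpos hc]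

theorem inf_smul_le_smul_inf {c : ℝ} (hc : 1 ≤ c) {a : E} (ha : 0 ≤ a) (b : E) :
    a ⊓ c • b ≤ c • (a ⊓ b) := by
  rw [smul_inf_of_nonneg (zero_le_one.trans hc)]
  exact inf_le_inf_right _ (le_smul_of_one_le_left ha hc)

theorem smul_inf_smul_eq_zero {a b : E} (ha : 0 ≤ a) (hb : 0 ≤ b) (h : a ⊓ b = 0) {c d : ℝ}
    (hc : 0 ≤ c) (hd : 0 ≤ d) : c • a ⊓ d • b = 0 := by
  refine le_antisymm ?_ (le_inf (smul_nonneg hc ha) (smul_nonneg hd hb))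
  calc c • a ⊓ d • b ≤ (max c d) • a ⊓ (max c d) • b :=
        inf_le_inf (smul_le_smul_of_nonneg_right (le_max_left _ _) ha)
          (smul_le_smul_of_nonneg_right (le_max_right _ _) hb)
    _ = 0 := by rw [← smul_inf_of_nonneg (hc.trans (le_max_left _ _)), h, smul_zero]

variable [IsOrderedAddMonoid E]

/-- The second factor is `c⁻¹` times the negative part of `a - c • b`. This is the source of
disjointness in `not_forall_le_posPart_sub`. -/
theorem posPart_sub_smul_inf_posPart_sub_smul {c : ℝ} (hc : 0 < c) (a b : E) :
    (a - c • b)⁺ ⊓ (b - c⁻¹ • a)⁺ = 0 := by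
  have h : b - c⁻¹ • a = c⁻¹ • (-(a - c • b)) := by
    rw [neg_sub, smul_sub, inv_smul_smul₀ hc.ne']
  rw [h, smul_posPart_of_nonneg (inv_nonneg.2 hc.le), posPart_neg]
  simpa using smul_inf_smul_eq_zero (posPart_nonneg _) (negPart_nonneg _)
    (posPart_inf_negPart_eq_zero (a - c • b)) zero_le_one (inv_nonneg.2 hc.le)

/-- If positive elements have sum at most `u`, then their excesses over `u / (k + 1)` are
`(k + 2)`-wise disjoint. -/
theorem nonpos_of_forall_le_posPart_sub {ι : Type*} {y : ι → E} {t u v : E} {s : Finset ι}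
    (hu : ∑ i ∈ s, y i ≤ u) (ht : u ≤ s.card • t) (hs : s.Nonempty)
    (hv : ∀ i ∈ s, v ≤ (y i - t)⁺) : v ≤ 0 := by
  let _ : DistribLattice E := AddCommGroup.toDistribLattice E
  have h1 : v ≤ s.inf' hs (fun i => (y i - t) ⊔ 0) := Finset.le_inf' _ _ hv
  rw [← Finset.inf'_sup_distrib_right] at h1
  refine h1.trans (sup_le ?_ le_rfl)
  have hc : (0 : ℝ) < s.card := by exact_mod_cast hs.card_pos
  refine le_of_smul_le_smul_left (a := (s.card : ℝ)) ?_ hc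
  rw [smul_zero, Nat.cast_smul_eq_nsmul]
  calc s.card • s.inf' hs (fun i => y i - t) ≤ ∑ i ∈ s, (y i - t) :=
        Finset.card_nsmul_le_sum _ _ _ fun i hi => Finset.inf'_le _ hi
    _ = ∑ i ∈ s, y i - s.card • t := by simp
    _ ≤ 0 := sub_nonpos.2 (hu.trans ht)

end VectorLattice

/-- Hahn-Banach: a sublinear functional is supported at every point. -/
theorem exists_linearMap_eq_and_le {V : Type*} [AddCommGroup V] [Module ℝ V] (N : V → ℝ)
    (N_hom : ∀ c : ℝ, 0 < c → ∀ x, N (c • x) = c * N x)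
    (N_add : ∀ x y, N (x + y) ≤ N x + N y) (x₀ : V) :
    ∃ g : V →ₗ[ℝ] ℝ, g x₀ = N x₀ ∧ ∀ x, g x ≤ N x := by
  have N0 : N 0 = 0 := by
    have := N_hom 2 two_pos 0
    rw [smul_zero] at this
    linarith
  have H : ∀ c : ℝ, c • x₀ = 0 → c • N x₀ = 0 := by
    intro c hc
    rcases smul_eq_zero.1 hc with rfl | rfl
    · rw [zero_smul]
    · rw [N0, smul_zero]
  obtain ⟨g, h1, hg⟩ := exists_extension_of_le_sublinear
    (LinearPMap.mkSpanSingleton' x₀ (N x₀) H : V →ₗ.[ℝ] ℝ) N N_hom N_add (by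
      rintro ⟨x, hx'⟩
      obtain ⟨c, rfl⟩ := Submodule.mem_span_singleton.1 hx'
      refine (LinearPMap.mkSpanSingleton'_apply x₀ (N x₀) H c hx').trans_le ?_
      show c * N x₀ ≤ N (c • x₀)
      rcases lt_trichotomy c 0 with hc | rfl | hc
      · have h2 := N_hom (-c) (neg_pos.2 hc) x₀
        have h3 := N_add (c • x₀) ((-c) • x₀)
        rw [← add_smul, add_neg_cancel, zero_smul, N0, h2] at h3
        linarith
      · simp [N0]
      · exact (N_hom c hc x₀).ge)
  exact ⟨g, (h1 ⟨x₀, Submodule.mem_span_singleton_self x₀⟩).trans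
    (LinearPMap.mkSpanSingleton'_apply_self x₀ (N x₀) H _), hg⟩

theorem exists_subseq_of_tendsto {P : ℕ → Prop} (hP : ∃ᶠ n in atTop, P n) {R : ℕ → ℕ → ℝ}
    (hR : ∀ i, Tendsto (R i) atTop (𝓝 0)) {δ : ℕ → ℝ} (hδ : ∀ n, 0 < δ n) (hδ' : Antitone δ) :
    ∃ φ : ℕ → ℕ, (∀ n, P (φ n)) ∧ ∀ i m, i < m → R (φ i) (φ m) ≤ δ m := by
  -- The second coordinate is a strictly increasing counter, hence at least `m` at stage `m`;
  -- antitonicity of `δ` then turns the bound at the counter into one at `m`.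
  obtain ⟨f, h1, h2⟩ := exists_seq_of_forall_finset_exists (α := ℕ × ℕ) (fun a => P a.1)
    (fun a b => a.2 < b.2 ∧ R a.1 b.1 ≤ δ b.2) (fun s _ => by
      set d := s.sup Prod.snd + 1
      have h : ∀ᶠ m in atTop, ∀ a ∈ s, R a.1 m ≤ δ d :=
        (Finset.eventually_all s).2 fun a _ => (hR a.1).eventually_le_const (hδ d)
      obtain ⟨m, hm, hm'⟩ := (hP.and_eventually h).exists
      exact ⟨(m, d), hm, fun a ha => ⟨Nat.lt_succ_of_le (Finset.le_sup (f := Prod.snd) ha),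
        hm' a ha⟩⟩)
  have hmono : StrictMono fun n => (f n).2 := fun i m him => (h2 i m him).1
  exact ⟨fun n => (f n).1, h1, fun i m him => (h2 i m him).2.trans (hδ' hmono.le_apply)⟩

theorem exists_frequently_le_of_not_tendsto {a : ℕ → ℝ} (ha : ∀ n, 0 ≤ a n)
    (h : ¬ Tendsto a atTop (𝓝 0)) : ∃ ε > 0, ∃ᶠ n in atTop, ε ≤ a n := by
  by_contra! hc
  refine h (tendsto_order.2 ⟨fun b hb => .of_forall fun n => hb.trans_le (ha n), fun b hb => ?_⟩)
  exact (hc b hb).mono fun n hn => hn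

/-! ### Weak `p`-summability as a norm bound on finite combinations -/

/-- The coefficients `lam` belong to the polar of the unit ball of `ℓ_p^n`. -/
def LpPolar (p : ℝ) {n : ℕ} (lam : Fin n → ℝ) : Prop :=
  ∀ a : Fin n → ℝ, ∑ k, |a k| ^ p ≤ 1 → ∑ k, lam k * a k ≤ 1

theorem rpow_sub_one_mul_le {p : ℝ} (hp : 1 ≤ p) {a b : ℝ} (ha : 0 ≤ a) (hb : 0 ≤ b) :
    b ^ (p - 1) * a ≤ (p - 1) / p * b ^ p + 1 / p * a ^ p := by
  have hp0 : 0 < p := by linarith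
  have h := Real.geom_mean_le_arith_mean2_weighted (w₁ := (p - 1) / p) (w₂ := 1 / p)
    (div_nonneg (by linarith) hp0.le) (by positivity) (Real.rpow_nonneg hb p)
    (Real.rpow_nonneg ha p) (by field_simp; ring)
  rwa [← Real.rpow_mul hb, ← Real.rpow_mul ha, mul_div_cancel₀ _ hp0.ne',
    mul_one_div_cancel hp0.ne', Real.rpow_one] at h

theorem sum_div_rpow {p B : ℝ} {n : ℕ} (hB : 0 ≤ B) (a : Fin n → ℝ) :
    ∑ k, |a k / B| ^ p = (∑ k, |a k| ^ p) / B ^ p := by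
  rw [Finset.sum_div]
  refine Finset.sum_congr rfl fun k _ => ?_
  rw [abs_div, abs_of_nonneg hB, Real.div_rpow (abs_nonneg _) hB]

theorem LpPolar.sum_mul_le {p : ℝ} {n : ℕ} {lam : Fin n → ℝ} (h : LpPolar p lam) {B : ℝ}
    (hB : 0 < B) {a : Fin n → ℝ} (ha : ∑ k, |a k| ^ p ≤ B ^ p) : ∑ k, lam k * a k ≤ B := by
  have h1 := h (fun k => a k / B) (by
    rw [sum_div_rpow hB.le]
    exact div_le_one_of_le₀ ha (Real.rpow_nonneg hB.le p))
  simp only [← mul_div_assoc, ← Finset.sum_div] at h1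
  rwa [div_le_one hB] at h1

section WeaklyPSummable

variable {Y : Type*} [NormedAddCommGroup Y] [NormedSpace ℝ Y] {p : ℝ}

theorem norm_inclusionInDoubleDual (v : Y) :
    ‖NormedSpace.inclusionInDoubleDual ℝ Y v‖ = ‖v‖ :=
  (NormedSpace.inclusionInDoubleDualLi ℝ).norm_map v

/-- Uniform boundedness, applied to all these combinations as functionals on the dual. The polar
replaces the conjugate exponent, so `p = 1` is not special. -/
theorem WeaklyPSummable.exists_norm_sum_le (hp : 1 ≤ p) {x : ℕ → Y} (hx : WeaklyPSummable p x) :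
    ∃ C : ℝ, ∀ (n : ℕ) (lam : Fin n → ℝ), LpPolar p lam → ‖∑ k, lam k • x k‖ ≤ C := by
  let ι := {v : Y // ∃ (n : ℕ) (lam : Fin n → ℝ), LpPolar p lam ∧ v = ∑ k, lam k • x k}
  obtain ⟨C, hC⟩ := banach_steinhaus (E := StrongDual ℝ Y) (ι := ι)
    (g := fun v => NormedSpace.inclusionInDoubleDual ℝ Y v.1) (fun f => by
      have hS : 0 ≤ ∑' k, |f (x k)| ^ p := tsum_nonneg fun k => Real.rpow_nonneg (abs_nonneg _) p
      -- Adding `1` gives `B ≤ B ^ p`, which avoids taking a `p`-th root.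
      set B := 1 + ∑' k, |f (x k)| ^ p with hB
      have hB1 : 1 ≤ B := by linarith
      have key : ∀ (n : ℕ) (lam : Fin n → ℝ), LpPolar p lam → ∀ g : StrongDual ℝ Y,
          (∀ k, |g (x k)| = |f (x k)|) → g (∑ k, lam k • x k) ≤ B := by
        intro n lam h g hg
        simp only [map_sum, map_smul, smul_eq_mul]
        refine h.sum_mul_le (by linarith) ?_
        calc ∑ k : Fin n, |g (x k)| ^ p = ∑ k ∈ Finset.range n, |f (x k)| ^ p := by
              simp only [hg]
              rw [Finset.sum_range]
          _ ≤ ∑' k, |f (x k)| ^ p :=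
              (hx f).sum_le_tsum _ fun k _ => Real.rpow_nonneg (abs_nonneg _) p
          _ ≤ B := by linarith
          _ ≤ B ^ p := Real.self_le_rpow_of_one_le hB1 hp
      refine ⟨B, ?_⟩
      rintro ⟨v, n, lam, h, rfl⟩
      rw [NormedSpace.dual_def, Real.norm_eq_abs, abs_le']
      refine ⟨key n lam h f fun _ => rfl, ?_⟩
      simpa using key n lam h (-f) fun k => by simp)
  refine ⟨C, fun n lam h => ?_⟩
  have h1 := hC ⟨_, n, lam, h, rfl⟩
  rwa [norm_inclusionInDoubleDual] at h1

theorem weaklyPSummable_of_norm_sum_le (hp : 1 ≤ p) {x : ℕ → Y} {C : ℝ}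
    (hC : ∀ (n : ℕ) (lam : Fin n → ℝ), LpPolar p lam → ‖∑ k, lam k • x k‖ ≤ C) :
    WeaklyPSummable p x := by
  intro f
  have hp0 : 0 < p := by linarith
  refine summable_of_sum_range_le (c := (‖f‖ * C) ^ p)
    (fun k => Real.rpow_nonneg (abs_nonneg _) p) fun n => ?_
  rw [Finset.sum_range]
  have hC0 : 0 ≤ C := (norm_nonneg _).trans (hC n (fun _ => 0) fun a _ => by simp)
  set S := ∑ k : Fin n, |f (x k)| ^ p with hS
  have hS0 : 0 ≤ S := Finset.sum_nonneg fun k _ => Real.rpow_nonneg (abs_nonneg _) p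
  rcases hS0.eq_or_lt with h0 | hSpos
  · rw [← h0]; positivity
  set s := S ^ (1 / p) with hs
  have hspos : 0 < s := Real.rpow_pos_of_pos hSpos _
  have hsp : s ^ p = S := by
    rw [hs, ← Real.rpow_mul hS0, one_div_mul_cancel hp0.ne', Real.rpow_one]
  set b : Fin n → ℝ := fun k => |f (x k)| / s with hb
  have hb0 : ∀ k, 0 ≤ b k := fun k => by positivity
  have hbsum : ∑ k, b k ^ p = 1 := by
    have h1 := sum_div_rpow (p := p) hspos.le fun k : Fin n => f (x k)
    rw [hsp, ← hS, div_self hSpos.ne'] at h1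
    rw [← h1]
    refine Finset.sum_congr rfl fun k _ => ?_
    rw [hb, abs_div, abs_of_pos hspos]
  have hsign : ∀ k : Fin n, |(SignType.sign (f (x k)) : ℝ)| ≤ 1 := fun k => by
    rcases lt_trichotomy (f (x k)) 0 with h | h | h <;> simp [h]
  -- These are the coefficients giving equality in Hölder's inequality; membership in the polar is
  -- Young's inequality.
  have hpol : LpPolar p fun k : Fin n => (SignType.sign (f (x k)) : ℝ) * b k ^ (p - 1) := by
    intro a ha
    calc ∑ k : Fin n, (SignType.sign (f (x k)) : ℝ) * b k ^ (p - 1) * a k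
        ≤ ∑ k, ((p - 1) / p * b k ^ p + 1 / p * |a k| ^ p) := by
          refine Finset.sum_le_sum fun k _ => ?_
          refine le_trans ?_ (rpow_sub_one_mul_le hp (abs_nonneg _) (hb0 k))
          refine (le_abs_self _).trans ?_
          rw [abs_mul, abs_mul, abs_of_nonneg (Real.rpow_nonneg (hb0 k) _)]
          exact mul_le_mul_of_nonneg_right (mul_le_of_le_one_left
            (Real.rpow_nonneg (hb0 k) _) (hsign k)) (abs_nonneg _)
      _ = (p - 1) / p + 1 / p * ∑ k, |a k| ^ p := by
          rw [Finset.sum_add_distrib, ← Finset.mul_sum, ← Finset.mul_sum, hbsum, mul_one]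
      _ ≤ (p - 1) / p + 1 / p * 1 := by gcongr
      _ = 1 := by field_simp; ring
  have hval : f (∑ k : Fin n, ((SignType.sign (f (x k)) : ℝ) * b k ^ (p - 1)) • x k) = s := by
    rw [map_sum]
    simp only [map_smul, smul_eq_mul]
    refine Eq.trans ?_ ((Finset.mul_sum _ _ s).symm.trans ((congrArg _ hbsum).trans (mul_one s)))
    refine Finset.sum_congr rfl fun k _ => ?_
    have h1 : b k ^ p = b k ^ (p - 1) * b k := by
      rw [← Real.rpow_add_one' (hb0 k) (by simpa using hp0.ne'), sub_add_cancel]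
    have h2 : s * b k = |f (x k)| := mul_div_cancel₀ _ hspos.ne'
    rw [h1, mul_left_comm, h2, ← sign_mul_self (f (x k))]
    ring
  rw [← hsp]
  refine Real.rpow_le_rpow hspos.le ?_ hp0.le
  rw [← hval]
  exact (le_abs_self _).trans ((f.le_opNorm _).trans
    (mul_le_mul_of_nonneg_left (hC n _ hpol) (norm_nonneg f)))

theorem WeaklyPSummable.tendsto_zero (hp : 1 ≤ p) {x : ℕ → Y} (hx : WeaklyPSummable p x)
    (f : StrongDual ℝ Y) : Tendsto (fun n => f (x n)) atTop (𝓝 0) := by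
  have hp0 : 0 < p := by linarith
  have h := ((hx f).tendsto_atTop_zero).rpow_const (p := 1 / p) (Or.inr (by positivity))
  rw [Real.zero_rpow (by positivity)] at h
  refine (tendsto_zero_iff_abs_tendsto_zero _).2 (h.congr fun n => ?_)
  rw [← Real.rpow_mul (abs_nonneg _), mul_one_div_cancel hp0.ne', Real.rpow_one]
  rfl

theorem exists_norm_le_of_forall_tendsto {x : ℕ → Y}
    (hx : ∀ f : StrongDual ℝ Y, Tendsto (fun n => f (x n)) atTop (𝓝 0)) :
    ∃ M : ℝ, ∀ n, ‖x n‖ ≤ M := by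
  obtain ⟨C, hC⟩ := banach_steinhaus (E := StrongDual ℝ Y)
    (g := fun n => NormedSpace.inclusionInDoubleDual ℝ Y (x n)) (fun f => by
      obtain ⟨C, hC⟩ := (hx f).norm.bddAbove_range
      exact ⟨C, fun n => hC ⟨n, rfl⟩⟩)
  exact ⟨C, fun n => (norm_inclusionInDoubleDual (x n)).symm.trans_le (hC n)⟩

end WeaklyPSummable

/-! ### Disjoint sequences in Banach lattices and cotype of the dual -/

section BanachLattice

variable {E : Type*} [NormedAddCommGroup E] [NormedSpace ℝ E] [Lattice E] [IsOrderedAddMonoid E]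
  [IsOrderedModule ℝ E] [HasSolidNorm E] {p : ℝ}

theorem norm_le_norm_of_abs_le {a b : E} (h : |a| ≤ b) : ‖a‖ ≤ ‖b‖ :=
  HasSolidNorm.solid (h.trans (le_abs_self b))

theorem DisjointSeq.mono {x y : ℕ → E} (hx : DisjointSeq x) (h : ∀ n, |y n| ≤ |x n|) :
    DisjointSeq y := fun m n hmn =>
  le_antisymm ((inf_le_inf (h m) (h n)).trans (hx m n hmn).le)
    (le_inf (abs_nonneg _) (abs_nonneg _))

theorem DisjointSeq.smul_inf_smul {x : ℕ → E} (hx : DisjointSeq x) {n : ℕ} (lam : Fin n → ℝ)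
    (i j : Fin n) (hij : i ≠ j) : |lam i • x i| ⊓ |lam j • x j| = 0 := by
  rw [abs_real_smul, abs_real_smul]
  exact smul_inf_smul_eq_zero (abs_nonneg _) (abs_nonneg _)
    (hx _ _ fun h => hij (Fin.ext h)) (abs_nonneg _) (abs_nonneg _)

/-- Disjointness gives `∑ |lam k • x k| ≤ |∑ lam k • x k|`, so the bound on finite combinations
passes to dominated sequences. -/
theorem WeaklyPSummable.of_abs_le (hp : 1 ≤ p) {x y : ℕ → E} (hx : WeaklyPSummable p x)
    (hd : DisjointSeq x) (h : ∀ n, |y n| ≤ |x n|) : WeaklyPSummable p y := by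
  obtain ⟨C, hC⟩ := hx.exists_norm_sum_le hp
  refine weaklyPSummable_of_norm_sum_le hp (C := C) fun n lam hlam => ?_
  refine le_trans (HasSolidNorm.solid ?_) (hC n lam hlam)
  calc |∑ k, lam k • y k| ≤ ∑ k, |lam k • y k| := abs_finset_sum_le _ _
    _ ≤ ∑ k, |lam k • x k| := by
        refine Finset.sum_le_sum fun k _ => ?_
        rw [abs_real_smul, abs_real_smul]
        exact smul_le_smul_of_nonneg_left (h k) (abs_nonneg _)
    _ ≤ |∑ k, lam k • x k| := sum_abs_le_abs_sum_of_disjoint (hd.smul_inf_smul lam) _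

/-- The supremum of the absolute values of a finite family. -/
def supAbs {ι : Type*} [Fintype ι] [Nonempty ι] (z : ι → E) : E :=
  Finset.univ.sup' Finset.univ_nonempty fun k => |z k|

section supAbs

variable {ι : Type*} [Fintype ι] [Nonempty ι]

theorem abs_le_supAbs (z : ι → E) (k : ι) : |z k| ≤ supAbs z :=
  Finset.le_sup' (fun k => |z k|) (Finset.mem_univ k)

theorem supAbs_le {z : ι → E} {w : E} (h : ∀ k, |z k| ≤ w) : supAbs z ≤ w :=
  Finset.sup'_le _ _ fun k _ => h k

theorem supAbs_nonneg (z : ι → E) : 0 ≤ supAbs z :=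
  (abs_nonneg _).trans (abs_le_supAbs z (Classical.arbitrary ι))

theorem norm_supAbs_le {z : ι → E} {w : E} (h : ∀ k, |z k| ≤ w) : ‖supAbs z‖ ≤ ‖w‖ :=
  norm_le_norm_of_abs_le ((abs_of_nonneg (supAbs_nonneg z)).trans_le (supAbs_le h))

theorem supAbs_smul_le {c : ℝ} (hc : 0 ≤ c) (z : ι → E) : supAbs (c • z) ≤ c • supAbs z :=
  supAbs_le fun k => by
    rw [Pi.smul_apply, abs_real_smul, abs_of_nonneg hc]
    exact smul_le_smul_of_nonneg_left (abs_le_supAbs z k) hc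

theorem supAbs_smul {c : ℝ} (hc : 0 < c) (z : ι → E) : supAbs (c • z) = c • supAbs z := by
  refine le_antisymm (supAbs_smul_le hc.le z) ?_
  have h := smul_le_smul_of_nonneg_left (supAbs_smul_le (inv_nonneg.2 hc.le) (c • z)) hc.le
  rwa [inv_smul_smul₀ hc.ne', smul_inv_smul₀ hc.ne'] at h

theorem norm_supAbs_add_le (x y : ι → E) :
    ‖supAbs (x + y)‖ ≤ ‖supAbs x‖ + ‖supAbs y‖ :=
  (norm_supAbs_le fun k => (abs_add_le (x k) (y k)).trans
    (add_le_add (abs_le_supAbs x k) (abs_le_supAbs y k))).trans (norm_add_le _ _)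

/-- The norm of a disjoint sum is attained by functionals `f k` all of whose combinations with
coefficients in `[-1, 1]` have norm at most one. -/
theorem exists_dual_family_of_disjoint {z : ι → E} (hz : ∀ i j, i ≠ j → |z i| ⊓ |z j| = 0) :
    ∃ f : ι → StrongDual ℝ E, ‖∑ k, z k‖ ≤ ∑ k, f k (z k) ∧
      ∀ r : ι → ℝ, (∀ k, |r k| ≤ 1) → ‖∑ k, r k • f k‖ ≤ 1 := by
  classical
  -- Hahn-Banach on the power `ι → E` with the norm `‖sup |z k|‖`; the `f k` are the coordinate
  -- restrictions of `F`. A combination of them at `w` is `F` at the family `r k • w`, whose norm is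
  -- at most `‖w‖`.
  obtain ⟨F, hF, hle⟩ := exists_linearMap_eq_and_le (fun z : ι → E => ‖supAbs z‖)
    (fun c hc z => by
      rw [supAbs_smul hc, norm_smul, Real.norm_of_nonneg hc.le])
    norm_supAbs_add_le z
  have habs : ∀ (y : ι → E) (w : E), (∀ k, |y k| ≤ |w|) → ‖F y‖ ≤ ‖w‖ := by
    intro y w h
    rw [← norm_abs_eq_norm w, Real.norm_eq_abs, abs_le']
    refine ⟨(hle y).trans (norm_supAbs_le h), ?_⟩
    rw [← map_neg]
    exact (hle _).trans (norm_supAbs_le fun k => by rw [Pi.neg_apply, abs_neg]; exact h k)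
  let f : ι → StrongDual ℝ E := fun k =>
    (F ∘ₗ LinearMap.single ℝ (fun _ => E) k).mkContinuous 1 fun w => by
      rw [one_mul]
      refine habs _ _ fun j => ?_
      rcases eq_or_ne j k with rfl | h
      · simp
      · simp [h]
  have hf : ∀ y : ι → E, ∑ k, f k (y k) = F y := fun y => by
    conv_rhs => rw [← Finset.univ_sum_single y, map_sum]
    rfl
  refine ⟨f, ?_, fun r hr => ContinuousLinearMap.opNorm_le_bound _ zero_le_one fun w => ?_⟩
  · rw [hf, hF]
    refine norm_le_norm_of_abs_le ((abs_finset_sum_le _ _).trans ?_)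
    exact sum_le_of_disjoint (fun _ => abs_nonneg _) hz (supAbs_nonneg z) (abs_le_supAbs z) _
  · have h1 : (∑ k, r k • f k) w = F fun k => r k • w := by
      rw [← hf]
      simp
    rw [h1, one_mul]
    refine habs _ _ fun k => ?_
    rw [abs_real_smul]
    exact smul_le_of_le_one_left (abs_nonneg _) (hr k)

end supAbs

theorem abs_rademacher_le_one (k : ℕ) (t : ℝ) : |rademacher k t| ≤ 1 := by
  unfold rademacher
  rcases Real.sign_apply_eq (Real.sin (2 ^ k * Real.pi * t)) with h | h | h <;> simp [h]

theorem HasCotype.hasDisjointProperty (h : HasCotype (StrongDual ℝ E) p) :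
    HasDisjointProperty E p := by
  obtain ⟨hp, C, hC0, hC⟩ := h
  have hp0 : 0 < p := by linarith
  rintro x ⟨M, hM⟩ hd
  have hM1 : 0 < max M 1 := lt_max_of_lt_right one_pos
  refine weaklyPSummable_of_norm_sum_le (by linarith) (C := max M 1 * C) fun n lam hlam => ?_
  rcases n with _ | n
  · simpa using (mul_pos hM1 hC0).le
  obtain ⟨f, hf, hr⟩ := exists_dual_family_of_disjoint (hd.smul_inf_smul lam)
  refine hf.trans ?_
  simp only [map_smul, smul_eq_mul]
  refine hlam.sum_mul_le (mul_pos hM1 hC0) ?_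
  have hint : (∫ t in (0 : ℝ)..1,
      ‖∑ k : Fin (n + 1), rademacher ((k : ℕ) + 1) t • f k‖ ^ 2) ≤ 1 := by
    have h1 := intervalIntegral.norm_integral_le_of_norm_le_const (a := 0) (b := 1) (C := 1)
      (f := fun t => ‖∑ k : Fin (n + 1), rademacher ((k : ℕ) + 1) t • f k‖ ^ 2) fun t _ => ?_
    · exact (le_abs_self _).trans (h1.trans (by simp))
    rw [Real.norm_eq_abs, abs_of_nonneg (by positivity)]
    exact pow_le_one₀ (norm_nonneg _) (hr _ fun k => abs_rademacher_le_one _ _)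
  have hint0 : 0 ≤ ∫ t in (0 : ℝ)..1,
      ‖∑ k : Fin (n + 1), rademacher ((k : ℕ) + 1) t • f k‖ ^ 2 :=
    intervalIntegral.integral_nonneg zero_le_one fun t _ => by positivity
  -- Rademacher values lie in `[-1, 1]`, so the cotype average of the `f k` is at most one.
  have hsum : ∑ k, ‖f k‖ ^ p ≤ C ^ p := by
    have h0 : 0 ≤ ∑ k, ‖f k‖ ^ p := Finset.sum_nonneg fun k _ => by positivity
    have h1 : (∑ k, ‖f k‖ ^ p) ^ (1 / p) ≤ C :=
      (hC _ f).trans (mul_le_of_le_one_right hC0.le (Real.rpow_le_one hint0 hint (by norm_num)))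
    have h2 := Real.rpow_le_rpow (Real.rpow_nonneg h0 _) h1 hp0.le
    rwa [← Real.rpow_mul h0, one_div_mul_cancel hp0.ne', Real.rpow_one] at h2
  calc ∑ k, |f k (x k)| ^ p ≤ ∑ k, (max M 1) ^ p * ‖f k‖ ^ p := by
        refine Finset.sum_le_sum fun k _ => ?_
        rw [← Real.mul_rpow hM1.le (norm_nonneg _)]
        refine Real.rpow_le_rpow (abs_nonneg _) ?_ hp0.le
        rw [mul_comm]
        exact (f k).le_opNorm_of_le ((hM k).trans (le_max_left _ _))
    _ ≤ (max M 1) ^ p * C ^ p := by rw [← Finset.mul_sum]; gcongr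
    _ = (max M 1 * C) ^ p := (Real.mul_rpow hM1.le hC0.le).symm

end BanachLattice

/-! ### Seminorms null along disjoint sequences -/

section DisjointNull

variable {E : Type*} [NormedAddCommGroup E] [NormedSpace ℝ E] [Lattice E]

/-- A continuous seminorm, monotone on the positive cone, that is null along all bounded
disjoint positive sequences. -/
structure DisjointNull (q : E → ℝ) : Prop where
  mono : ∀ {x y : E}, 0 ≤ x → x ≤ y → q x ≤ q y
  add_le : ∀ x y : E, q (x + y) ≤ q x + q y
  smul : ∀ {c : ℝ}, 0 ≤ c → ∀ x : E, q (c • x) = c * q x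
  bound : ∃ C : ℝ, ∀ x : E, q x ≤ C * ‖x‖
  tendsto_zero : ∀ d : ℕ → E, (∀ n, 0 ≤ d n) → (∃ M : ℝ, ∀ n, ‖d n‖ ≤ M) →
    (∀ i j, i < j → d i ⊓ d j = 0) → Tendsto (fun n => q (d n)) atTop (𝓝 0)

namespace DisjointNull

variable {q : E → ℝ} (hq : DisjointNull q)

include hq

theorem map_zero : q 0 = 0 := by simpa using hq.smul le_rfl (0 : E)

theorem nonneg {x : E} (hx : 0 ≤ x) : 0 ≤ q x := hq.map_zero.symm.trans_le (hq.mono le_rfl hx)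

theorem le_add_of_le {x y z : E} (hx : 0 ≤ x) (h : x ≤ y + z) : q x ≤ q y + q z :=
  (hq.mono hx h).trans (hq.add_le y z)

theorem sum_le {ι : Type*} (s : Finset ι) (z : ι → E) : q (∑ i ∈ s, z i) ≤ ∑ i ∈ s, q (z i) :=
  Finset.le_sum_of_subadditive q hq.map_zero.le hq.add_le s z

variable [IsOrderedAddMonoid E] [IsOrderedModule ℝ E] [HasSolidNorm E]

/-- Disjointification: subtracting also `2⁻ⁿ • y`, with `y = ∑ 2⁻ⁿ • w n`, makes the excesses
disjoint, while `q (2⁻ⁿ • y)` tends to zero. -/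
theorem not_forall_le_posPart_sub [CompleteSpace E] {w : ℕ → E} (hw : ∀ n, 0 ≤ w n) {M : ℝ}
    (hM : ∀ n, ‖w n‖ ≤ M) {ε : ℝ} (hε : 0 < ε) :
    ¬ ∀ n, ε ≤ q (w n - (4 : ℝ) ^ n • ∑ i ∈ Finset.range n, w i)⁺ := by
  intro h
  have hsum : Summable fun n => (1 / 2 : ℝ) ^ n • w n := by
    refine Summable.of_norm_bounded (summable_geometric_two.mul_right M) fun n => ?_
    rw [norm_smul, norm_pow, Real.norm_of_nonneg (by norm_num)]
    exact mul_le_mul_of_nonneg_left (hM n) (by positivity)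
  set y := ∑' n, (1 / 2 : ℝ) ^ n • w n with hy
  have hle : ∀ n, (1 / 2 : ℝ) ^ n • w n ≤ y := fun n =>
    hsum.le_tsum n fun j _ => smul_nonneg (by positivity) (hw j)
  have hy0 : 0 ≤ y := (smul_nonneg (by positivity) (hw 0)).trans (hle 0)
  set S : ℕ → E := fun n => (4 : ℝ) ^ n • ∑ i ∈ Finset.range n, w i with hS
  have hS0 : ∀ n, 0 ≤ S n := fun n =>
    smul_nonneg (by positivity) (Finset.sum_nonneg fun i _ => hw i)
  set d : ℕ → E := fun n => (w n - (S n + (1 / 2 : ℝ) ^ n • y))⁺ with hd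
  have hd0 : ∀ n, 0 ≤ d n := fun n => posPart_nonneg _
  have hy' : ∀ n, 0 ≤ (1 / 2 : ℝ) ^ n • y := fun n => smul_nonneg (by positivity) hy0
  have hdle : ∀ n (v : E), v ≤ S n + (1 / 2 : ℝ) ^ n • y → d n ≤ (w n - v)⁺ := fun n v hv =>
    posPart_mono (sub_le_sub_left hv _)
  have hlim := hq.tendsto_zero d hd0 ⟨M, fun n => by
    refine (norm_le_norm_of_abs_le ?_).trans (hM n)
    rw [abs_of_nonneg (hd0 n)]
    have := hdle n 0 (add_nonneg (hS0 n) (hy' n))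
    rwa [sub_zero, posPart_of_nonneg (hw n)] at this⟩ (by
    intro i n hin
    refine le_antisymm ?_ (le_inf (hd0 i) (hd0 n))
    have h4 : (0 : ℝ) < 4 ^ n := by positivity
    -- For `i < n`, what is subtracted from `w n` dominates `4ⁿ • w i`, and what is subtracted from
    -- `w i` dominates `2⁻ⁱ • 2⁻ⁿ • w n ≥ 4⁻ⁿ • w n`.
    rw [inf_comm, ← posPart_sub_smul_inf_posPart_sub_smul h4 (w n) (w i)]
    refine inf_le_inf (hdle n _ ?_) (hdle i _ ?_)
    · refine le_add_of_le_of_nonneg (smul_le_smul_of_nonneg_left ?_ h4.le) (hy' n)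
      exact Finset.single_le_sum (fun j _ => hw j) (Finset.mem_range.2 hin)
    · refine le_add_of_nonneg_of_le (hS0 i) ?_
      refine le_trans ?_ (smul_le_smul_of_nonneg_left (hle n) (by positivity))
      rw [smul_smul]
      refine smul_le_smul_of_nonneg_right ?_ (hw n)
      have h5 : ((4 : ℝ) ^ n)⁻¹ = (1 / 2) ^ n * (1 / 2) ^ n := by
        rw [← mul_pow, ← inv_pow]; norm_num
      rw [h5]
      exact mul_le_mul_of_nonneg_right
        (pow_le_pow_of_le_one (by norm_num) (by norm_num) hin.le) (by positivity))
  have hlim2 : Tendsto (fun n => q (d n) + (1 / 2 : ℝ) ^ n * q y) atTop (𝓝 (0 + 0 * q y)) :=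
    hlim.add ((tendsto_pow_atTop_nhds_zero_of_lt_one (by norm_num) (by norm_num)).mul_const _)
  rw [zero_mul, add_zero] at hlim2
  refine hε.not_ge (ge_of_tendsto' hlim2 fun n => (h n).trans ?_)
  rw [← hq.smul (by positivity)]
  refine hq.le_add_of_le (posPart_nonneg _) ?_
  have := le_posPart_sub_add (w n - S n) ((1 / 2 : ℝ) ^ n • y)
  rw [posPart_def, sup_le_iff]
  refine ⟨?_, add_nonneg (hd0 n) (hy' n)⟩
  rwa [sub_sub] at this

theorem exists_forall_posPart_sub_lt [CompleteSpace E] {A : Set E} (hA : ∀ x ∈ A, 0 ≤ x) {M : ℝ}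
    (hM : ∀ x ∈ A, ‖x‖ ≤ M) {ε : ℝ} (hε : 0 < ε) :
    ∃ u : E, 0 ≤ u ∧ ∀ x ∈ A, q (x - u)⁺ < ε := by
  by_contra! h
  choose! W hWA hW using h
  -- If no `u` works, `4ⁿ` times the sum of the terms already chosen fails too, and a witness of its
  -- failure is the next term.
  let S : ℕ → {u : E // 0 ≤ u} := fun n => Nat.rec ⟨0, le_rfl⟩ (fun n s =>
    ⟨s.1 + W ((4 : ℝ) ^ n • s.1), add_nonneg s.2 (hA _ (hWA _ (smul_nonneg (by positivity) s.2)))⟩) n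
  have hS : ∀ n, 0 ≤ (4 : ℝ) ^ n • (S n).1 := fun n => smul_nonneg (by positivity) (S n).2
  have hsum : ∀ n, (S n).1 = ∑ i ∈ Finset.range n, W ((4 : ℝ) ^ i • (S i).1) := by
    intro n
    induction n with
    | zero => rfl
    | succ n ih => rw [Finset.sum_range_succ, ← ih]
  refine hq.not_forall_le_posPart_sub (w := fun n => W ((4 : ℝ) ^ n • (S n).1))
    (fun n => hA _ (hWA _ (hS n))) (fun n => hM _ (hWA _ (hS n))) hε fun n => ?_
  rw [← hsum n]
  exact hW _ (hS n)

theorem tendsto_zero_of_inf_tendsto [CompleteSpace E] {w : ℕ → E} (hw : ∀ n, 0 ≤ w n) {M : ℝ}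
    (hM : ∀ n, ‖w n‖ ≤ M)
    (h : ∀ i, Tendsto (fun m => q (w m ⊓ w i)) atTop (𝓝 0)) :
    Tendsto (fun n => q (w n)) atTop (𝓝 0) := by
  by_contra hlim
  obtain ⟨ε, hε, hfreq⟩ := exists_frequently_le_of_not_tendsto (fun n => hq.nonneg (hw n)) hlim
  -- The rate `8⁻ⁿ` absorbs the factor `4ⁿ` and the `n` summands, because `n * 2⁻ⁿ ≤ 1`.
  obtain ⟨φ, h1, h2⟩ := exists_subseq_of_tendsto hfreq h (δ := fun n => ε / 2 * (1 / 8) ^ n)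
    (fun n => by positivity) fun i j hij => mul_le_mul_of_nonneg_left
      (pow_le_pow_of_le_one (by norm_num) (by norm_num) hij) (by positivity)
  refine hq.not_forall_le_posPart_sub (w := fun n => w (φ n)) (fun n => hw _) (fun n => hM _)
    (half_pos hε) fun n => ?_
  set V := (4 : ℝ) ^ n • ∑ i ∈ Finset.range n, w (φ i) with hV
  have hsum0 : 0 ≤ ∑ i ∈ Finset.range n, w (φ i) := Finset.sum_nonneg fun i _ => hw _
  have hle : w (φ n) ⊓ V ≤ (4 : ℝ) ^ n • ∑ i ∈ Finset.range n, w (φ n) ⊓ w (φ i) :=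
    (inf_smul_le_smul_inf (one_le_pow₀ (by norm_num)) (hw _) _).trans
      (smul_le_smul_of_nonneg_left (inf_sum_le_sum_inf (hw _) (fun i => hw _) _) (by positivity))
  have hqle : q (w (φ n) ⊓ V) ≤ ε / 2 := by
    refine (hq.mono (le_inf (hw _) (smul_nonneg (by positivity) hsum0)) hle).trans ?_
    rw [hq.smul (by positivity)]
    calc (4 : ℝ) ^ n * q (∑ i ∈ Finset.range n, w (φ n) ⊓ w (φ i))
        ≤ 4 ^ n * ∑ i ∈ Finset.range n, ε / 2 * (1 / 8) ^ n := by
          gcongr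
          exact (hq.sum_le _ _).trans (Finset.sum_le_sum fun i hi =>
            h2 i n (Finset.mem_range.1 hi))
      _ = n * (1 / 2) ^ n * (ε / 2) := by
          rw [Finset.sum_const, Finset.card_range, nsmul_eq_mul]
          have : (1 / 2 : ℝ) ^ n = 4 ^ n * (1 / 8) ^ n := by rw [← mul_pow]; norm_num
          rw [this]; ring
      _ ≤ 1 * (ε / 2) := by
          gcongr
          rw [one_div, inv_pow, ← div_eq_mul_inv]
          refine div_le_one_of_le₀ ?_ (by positivity)
          exact_mod_cast Nat.lt_two_pow_self.le
      _ = ε / 2 := one_mul _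
  have hadd := hq.add_le (w (φ n) - V)⁺ (w (φ n) ⊓ V)
  rw [← sub_inf_eq_posPart_sub, sub_add_cancel] at hadd
  rw [← sub_inf_eq_posPart_sub]
  linarith [h1 n]

/-- Induction on `k`: meeting the later terms with a fixed `w i` lowers the order of disjointness by
one, and `tendsto_zero_of_inf_tendsto` recovers `w`. -/
theorem tendsto_zero_of_card_disjoint [CompleteSpace E] (k : ℕ) {w : ℕ → E} (hw : ∀ n, 0 ≤ w n)
    {M : ℝ} (hM : ∀ n, ‖w n‖ ≤ M)
    (hk : ∀ (s : Finset ℕ), s.card = k + 1 → ∀ v : E, (∀ i ∈ s, v ≤ w i) → v ≤ 0) :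
    Tendsto (fun n => q (w n)) atTop (𝓝 0) := by
  induction k generalizing w with
  | zero =>
    have h0 : ∀ n, w n = 0 := fun n =>
      le_antisymm (hk {n} (by simp) (w n) (by simp)) (hw n)
    simp [h0, hq.map_zero]
  | succ k ih =>
    refine hq.tendsto_zero_of_inf_tendsto hw hM fun i => ?_
    -- The shift keeps `i` out of the remaining indices, so inserting it raises the cardinality.
    rw [← tendsto_add_atTop_iff_nat (i + 1)]
    refine ih (w := fun m => w (m + (i + 1)) ⊓ w i) (fun m => le_inf (hw _) (hw _)) (fun m => ?_)
      fun s hs v hv => ?_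
    · refine (norm_le_norm_of_abs_le ?_).trans (hM i)
      rw [abs_of_nonneg (le_inf (hw _) (hw _))]
      exact inf_le_right
    · have hi : i ∉ s.map (addRightEmbedding (i + 1)) := by
        simp only [Finset.mem_map, addRightEmbedding_apply, not_exists, not_and]
        intro a _
        omega
      refine hk (insert i (s.map (addRightEmbedding (i + 1)))) (by simp [hi, hs]) v
        fun j hj => ?_
      rcases Finset.mem_insert.1 hj with rfl | hj
      · obtain ⟨a, ha⟩ := Finset.card_pos.1 (by omega : 0 < s.card)
        exact (hv a ha).trans inf_le_right
      · obtain ⟨a, ha, rfl⟩ := Finset.mem_map.1 hj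
        exact (hv a ha).trans inf_le_left

/-- Split `y n` at the level `u / (k + 1)`: the level is small in `q`, and no `k + 1` of the
excesses have a nonzero positive lower bound. -/
theorem tendsto_zero_of_sum_le [CompleteSpace E] {y : ℕ → E} (hy : ∀ n, 0 ≤ y n) {u : E}
    (hu : ∀ n, ∑ i ∈ Finset.range n, y i ≤ u) : Tendsto (fun n => q (y n)) atTop (𝓝 0) := by
  have hsum : ∀ s : Finset ℕ, ∑ i ∈ s, y i ≤ u := fun s =>
    (Finset.sum_le_sum_of_subset_of_nonneg s.subset_range_sup_succ fun i _ _ => hy i).trans (hu _)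
  have hyu : ∀ n, y n ≤ u := fun n => by simpa using hsum {n}
  have hu0 : 0 ≤ u := (hy 0).trans (hyu 0)
  rw [Metric.tendsto_atTop]
  intro ε hε
  obtain ⟨k, hk⟩ := exists_nat_gt (q u / (ε / 2))
  have hk1 : (0 : ℝ) < (k + 1 : ℕ) := by positivity
  set t := ((k + 1 : ℕ) : ℝ)⁻¹ • u with ht
  have hqt : q t < ε / 2 := by
    rw [ht, hq.smul (by positivity), inv_mul_lt_iff₀ hk1]
    rw [div_lt_iff₀ (half_pos hε)] at hk
    push_cast
    linarith
  have hlim := hq.tendsto_zero_of_card_disjoint k (w := fun n => (y n - t)⁺)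
    (fun n => posPart_nonneg _) (M := ‖u‖) (fun n => by
      refine norm_le_norm_of_abs_le ?_
      rw [abs_of_nonneg (posPart_nonneg _), posPart_def, sup_le_iff]
      exact ⟨(sub_le_self _ (smul_nonneg (by positivity) hu0)).trans (hyu n), hu0⟩)
    (fun s hs v hv => nonpos_of_forall_le_posPart_sub (hsum s)
      (by rw [hs, ht, ← Nat.cast_smul_eq_nsmul ℝ, smul_inv_smul₀ hk1.ne'])
      (Finset.card_pos.1 (by omega)) hv)
  obtain ⟨N, hN⟩ := (Metric.tendsto_atTop.1 hlim) (ε / 2) (half_pos hε)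
  refine ⟨N, fun n hn => ?_⟩
  have h1 := hN n hn
  rw [Real.dist_eq, sub_zero] at h1 ⊢
  rw [abs_of_nonneg (hq.nonneg (hy n))]
  linarith [hq.le_add_of_le (hy n) (le_posPart_sub_add (y n) t), le_abs_self (q (y n - t)⁺)]

/-- Otherwise, increments of `q`-size at least `ε` could be chosen successively; they telescope
below `u`, against `tendsto_zero_of_sum_le`. -/
theorem exists_forall_sub_lt_of_monotone [CompleteSpace E] {s : ℕ → E} (hs : Monotone s) {u : E}
    (h0 : ∀ n, 0 ≤ s n) (hu : ∀ n, s n ≤ u) {ε : ℝ} (hε : 0 < ε) :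
    ∃ N, ∀ n ≥ N, q (s n - s N) < ε := by
  by_contra! h
  choose g hg hgε using h
  have hlim := hq.tendsto_zero_of_sum_le (u := u)
    (y := fun k => s (g^[k + 1] 0) - s (g^[k] 0))
    (fun k => sub_nonneg.2 (hs (by rw [Function.iterate_succ_apply']; exact hg _)))
    (fun n => by
      rw [Finset.sum_range_sub fun k => s (g^[k] 0)]
      exact (sub_le_self _ (h0 _)).trans (hu _))
  refine hε.not_ge (ge_of_tendsto' hlim fun k => ?_)
  rw [Function.iterate_succ_apply']
  exact hgε _

/-- Dominating by `q x⁺` instead of `q x` forces positivity, as it vanishes on the negative cone. -/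
theorem exists_positive_functional {z : E} (hz : 0 ≤ z) :
    ∃ f : StrongDual ℝ E, f z = q z ∧ (∀ x, 0 ≤ x → 0 ≤ f x) ∧ ∀ x, 0 ≤ x → f x ≤ q x := by
  obtain ⟨g, hgz, hg⟩ := exists_linearMap_eq_and_le (fun x => q x⁺)
    (fun c hc x => by rw [smul_posPart_of_nonneg hc.le, hq.smul hc.le])
    (fun x y => hq.le_add_of_le (posPart_nonneg _) (by
      rw [posPart_def, sup_le_iff]
      exact ⟨add_le_add (le_posPart x) (le_posPart y),
        add_nonneg (posPart_nonneg x) (posPart_nonneg y)⟩)) z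
  obtain ⟨C, hC⟩ := hq.bound
  have hCabs : ∀ x : E, q |x| ≤ C * ‖x‖ := fun x => by
    simpa [norm_abs_eq_norm] using hC |x|
  have hle : ∀ x, g x ≤ C * ‖x‖ := fun x => (hg x).trans ((hq.mono (posPart_nonneg _) (by
    rw [posPart_def, sup_le_iff]; exact ⟨le_abs_self x, abs_nonneg x⟩)).trans (hCabs x))
  refine ⟨g.mkContinuous C fun x => ?_, ?_, fun x hx => ?_, fun x hx => ?_⟩
  · rw [Real.norm_eq_abs, abs_le']
    exact ⟨hle x, by simpa using hle (-x)⟩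
  · rw [LinearMap.mkContinuous_apply, hgz, posPart_of_nonneg hz]
  · have h1 := hg (-x)
    rw [posPart_eq_zero.2 (neg_nonpos.2 hx), hq.map_zero, map_neg] at h1
    rw [LinearMap.mkContinuous_apply]
    linarith
  · have h1 := hg x
    rwa [posPart_of_nonneg hx] at h1

end DisjointNull

end DisjointNull

/-! ### Positive weakly null sequences -/

section WeaklyNull

variable {E : Type*} [NormedAddCommGroup E] [NormedSpace ℝ E] [Lattice E]
  [IsOrderedAddMonoid E] [IsOrderedModule ℝ E]

theorem partialSups_le_sum {z : ℕ → E} (hz : ∀ n, 0 ≤ z n) (n : ℕ) :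
    partialSups z n ≤ ∑ i ∈ Finset.range (n + 1), z i :=
  partialSups_le _ _ _ fun _ hj =>
    Finset.single_le_sum (fun i _ => hz i) (Finset.mem_range.2 (Nat.lt_succ_of_le hj))

theorem sum_geometric_half_le (n : ℕ) : ∑ i ∈ Finset.range n, (1 / 2 : ℝ) ^ i ≤ 2 :=
  (summable_geometric_two.sum_le_tsum _ fun _ _ => by positivity).trans tsum_geometric_two.le

variable [HasSolidNorm E] [CompleteSpace E]

/-- An almost decreasing order bounded sequence is, up to a small error in `q`, dominated on a
tail by each of its later terms. -/
theorem DisjointNull.exists_forall_le_add {q : E → ℝ} (hq : DisjointNull q) {a : ℕ → E} {u : E}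
    (ha : ∀ n, 0 ≤ a n) (hau : ∀ n, a n ≤ u) {ε : ℝ} (hε : 0 < ε)
    (hdec : ∀ i n, i < n → q (a n - a i)⁺ ≤ ε * (1 / 2) ^ i) :
    ∃ N, ∀ m ≥ N, ∃ r s : E, 0 ≤ r ∧ 0 ≤ s ∧ q r ≤ 2 * ε ∧ q s < ε ∧ a N ≤ r + s + a m := by
  -- `u - c n` is the running infimum of `a`. In the splitting, `r` is the excess of `a N` over it,
  -- and `s` is its further decrease up to `m`.
  set c : ℕ → E := fun n => partialSups (fun i => u - a i) n with hc
  have hle : ∀ n, u - a n ≤ c n := fun n => le_partialSups (fun i => u - a i) n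
  have hcu : ∀ n, c n ≤ u := fun n => partialSups_le _ _ _ fun i _ => sub_le_self _ (ha i)
  obtain ⟨N, hN⟩ := hq.exists_forall_sub_lt_of_monotone (s := c)
    (partialSups fun i => u - a i).monotone
    (fun n => (sub_nonneg.2 (hau n)).trans (hle n)) hcu hε
  refine ⟨N, fun m hm => ⟨c N - (u - a N), c m - c N, sub_nonneg.2 (hle N),
    sub_nonneg.2 ((partialSups fun i => u - a i).monotone hm), ?_, hN m hm, ?_⟩⟩
  · have h1 : c N - (u - a N) ≤ ∑ i ∈ Finset.range N, (a N - a i)⁺ := by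
      rw [sub_le_iff_le_add]
      refine partialSups_le _ _ _ fun i hi => ?_
      rcases hi.eq_or_lt with rfl | hi
      · exact le_add_of_nonneg_left (Finset.sum_nonneg fun i _ => posPart_nonneg _)
      · refine le_trans ?_ (add_le_add_left (Finset.single_le_sum
          (f := fun i => (a N - a i)⁺) (fun i _ => posPart_nonneg _) (Finset.mem_range.2 hi)) _)
        rw [← sub_le_iff_le_add]
        simpa using le_posPart (a N - a i)
    calc q (c N - (u - a N)) ≤ ∑ i ∈ Finset.range N, q (a N - a i)⁺ :=
          (hq.mono (sub_nonneg.2 (hle N)) h1).trans (hq.sum_le _ _)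
      _ ≤ ∑ i ∈ Finset.range N, ε * (1 / 2) ^ i :=
          Finset.sum_le_sum fun i hi => hdec i N (Finset.mem_range.1 hi)
      _ ≤ 2 * ε := by
          rw [← Finset.mul_sum, mul_comm]
          exact mul_le_mul_of_nonneg_right (sum_geometric_half_le N) hε.le
  · have h1 : u - c m ≤ a m := sub_le_comm.1 (hle m)
    have h2 : c N - (u - a N) + (c m - c N) + (u - c m) = a N := by abel
    exact h2.symm.trans_le (add_le_add_right h1 _)

theorem DisjointNull.tendsto_zero_of_le {q : E → ℝ} (hq : DisjointNull q) {z : ℕ → E} {u : E}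
    (hz : ∀ n, 0 ≤ z n) (hzu : ∀ n, z n ≤ u)
    (hweak : ∀ f : StrongDual ℝ E, (∀ x, 0 ≤ x → 0 ≤ f x) →
      Tendsto (fun n => f (z n)) atTop (𝓝 0)) :
    Tendsto (fun n => q (z n)) atTop (𝓝 0) := by
  by_contra hlim
  obtain ⟨ε, hε, hfreq⟩ := exists_frequently_le_of_not_tendsto (fun n => hq.nonneg (hz n)) hlim
  choose f hfz hf0 hfq using fun n => hq.exists_positive_functional (hz n)
  have hfmono : ∀ n {x y : E}, x ≤ y → f n x ≤ f n y := fun n x y h => by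
    simpa using hf0 n (y - x) (sub_nonneg.2 h)
  obtain ⟨φ, h1, h2⟩ := exists_subseq_of_tendsto hfreq (fun i => hweak (f i) (hf0 i))
    (δ := fun n => ε / 8 * (1 / 2) ^ n)
    (fun n => by positivity) fun i j hij => mul_le_mul_of_nonneg_left
      (pow_le_pow_of_le_one (by norm_num) (by norm_num) hij) (by positivity)
  -- `s n (k n)` stands in for the supremum of the tail from `n`: enlarging the finite range changes
  -- it little in `q`, so these elements almost decrease.
  let s : ℕ → ℕ → E := fun n => partialSups fun i => z (φ (n + i))
  have hs0 : ∀ n j, 0 ≤ s n j := fun n j =>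
    (hz _).trans (le_partialSups_of_le (fun i => z (φ (n + i))) (Nat.zero_le j))
  have hsu : ∀ n j, s n j ≤ u := fun n j => partialSups_le _ _ _ fun i _ => hzu _
  have hs : ∀ i j n k, i ≤ n → n + k ≤ i + j → s n k ≤ s i j := fun i j n k hin hnk =>
    partialSups_le _ _ _ fun l hl => by
      have h := le_partialSups_of_le (fun l => z (φ (i + l))) (by omega : n + l - i ≤ j)
      simp only [show i + (n + l - i) = n + l by omega] at h
      exact h
  choose k hk using fun n => hq.exists_forall_sub_lt_of_monotone
    (partialSups fun i => z (φ (n + i))).monotone (hs0 n) (hsu n)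
    (show 0 < ε / 8 * (1 / 2 : ℝ) ^ n by positivity)
  obtain ⟨N, hN⟩ := hq.exists_forall_le_add (a := fun n => s n (k n)) (fun n => hs0 _ _)
    (fun n => hsu _ _) (show 0 < ε / 8 by positivity) fun i n hin => by
      refine le_trans (hq.mono (posPart_nonneg _) ?_)
        (hk i (n + k n + k i) (by omega)).le
      rw [posPart_def, sup_le_iff]
      exact ⟨sub_le_sub_right (hs _ _ _ _ hin.le (by omega)) _,
        sub_nonneg.2 (hs _ _ _ _ le_rfl (by omega))⟩
  obtain ⟨r, t, hr, ht, hqr, hqt, hle⟩ := hN (N + 1) (by omega)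
  have h3 : f (φ N) (s (N + 1) (k (N + 1))) ≤ ε / 4 := by
    calc f (φ N) (s (N + 1) (k (N + 1)))
        ≤ ∑ i ∈ Finset.range (k (N + 1) + 1), f (φ N) (z (φ (N + 1 + i))) := by
          rw [← map_sum]
          exact hfmono _ (partialSups_le_sum (fun i => hz _) _)
      _ ≤ ∑ i ∈ Finset.range (k (N + 1) + 1), ε / 8 * (1 / 2) ^ i := by
          refine Finset.sum_le_sum fun i _ => (h2 N (N + 1 + i) (by omega)).trans ?_
          exact mul_le_mul_of_nonneg_left
            (pow_le_pow_of_le_one (by norm_num) (by norm_num) (by omega)) (by positivity)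
      _ ≤ ε / 8 * 2 := by
          rw [← Finset.mul_sum]
          exact mul_le_mul_of_nonneg_left (sum_geometric_half_le _) (by positivity)
      _ = ε / 4 := by ring
  have h4 : z (φ N) ≤ r + t + s (N + 1) (k (N + 1)) :=
    (le_partialSups_of_le (fun i => z (φ (N + i))) (Nat.zero_le (k N))).trans hle
  have h5 := hfmono (φ N) h4
  rw [map_add, map_add, hfz] at h5
  -- `ε ≤ f (z (φ N))` for `f = f (φ N)`, but the three terms on the right contribute at most `ε/4 +
  -- ε/8 + ε/4`.
  linarith [h1 N, hfq (φ N) r hr, hfq (φ N) t ht]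

theorem DisjointNull.tendsto_zero_of_weakly_null {q : E → ℝ} (hq : DisjointNull q) {x : ℕ → E}
    (hx : ∀ n, 0 ≤ x n)
    (hweak : ∀ f : StrongDual ℝ E, Tendsto (fun n => f (x n)) atTop (𝓝 0)) :
    Tendsto (fun n => q (x n)) atTop (𝓝 0) := by
  obtain ⟨M, hM⟩ := exists_norm_le_of_forall_tendsto hweak
  rw [Metric.tendsto_atTop]
  intro ε hε
  obtain ⟨u, hu, hxu⟩ := hq.exists_forall_posPart_sub_lt (A := Set.range x)
    (by rintro _ ⟨n, rfl⟩; exact hx n) (M := M) (by rintro _ ⟨n, rfl⟩; exact hM n) (half_pos hε)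
  have hlim := hq.tendsto_zero_of_le (z := fun n => x n ⊓ u) (fun n => le_inf (hx n) hu)
    (fun n => inf_le_right) fun f hf => squeeze_zero (fun n => hf _ (le_inf (hx n) hu))
      (fun n => by simpa using hf (x n - x n ⊓ u) (sub_nonneg.2 inf_le_left)) (hweak f)
  obtain ⟨N, hN⟩ := (Metric.tendsto_atTop.1 hlim) (ε / 2) (half_pos hε)
  refine ⟨N, fun n hn => ?_⟩
  have h1 := hN n hn
  rw [Real.dist_eq, sub_zero] at h1 ⊢
  rw [abs_of_nonneg (hq.nonneg (hx n))]
  have h2 := hq.add_le (x n - u)⁺ (x n ⊓ u)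
  rw [← sub_inf_eq_posPart_sub, sub_add_cancel, sub_inf_eq_posPart_sub] at h2
  linarith [hxu _ ⟨n, rfl⟩, le_abs_self (q (x n ⊓ u))]

end WeaklyNull

/-! ### The seminorm of an operator -/

section qSeminorm

variable {E X : Type*} [NormedAddCommGroup E] [NormedSpace ℝ E] [Lattice E]
  [IsOrderedAddMonoid E] [IsOrderedModule ℝ E] [HasSolidNorm E]
  [NormedAddCommGroup X] [NormedSpace ℝ X] (T : E →L[ℝ] X)

theorem norm_le_qSeminorm {x y : E} (h : |y| ≤ |x|) : ‖T y‖ ≤ qSeminorm T x :=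
  (isLUB_qSeminorm T x).1 ⟨y, h, rfl⟩

theorem qSeminorm_le {x : E} {c : ℝ} (h : ∀ y : E, |y| ≤ |x| → ‖T y‖ ≤ c) :
    qSeminorm T x ≤ c :=
  (isLUB_qSeminorm T x).2 (by rintro _ ⟨y, hy, rfl⟩; exact h y hy)

theorem qSeminorm_nonneg (x : E) : 0 ≤ qSeminorm T x :=
  (norm_nonneg _).trans (norm_le_qSeminorm T le_rfl)

/-- Riesz decomposition, in the form of a splitting of `y` with `|y| ≤ |x₁| + |x₂|`. -/
theorem exists_add_eq_of_abs_le {y a b : E} (ha : 0 ≤ a) (hb : 0 ≤ b) (h : |y| ≤ a + b) :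
    ∃ y₁ y₂ : E, y = y₁ + y₂ ∧ |y₁| ≤ a ∧ |y₂| ≤ b := by
  have h1 : y ≤ a + b := (le_abs_self y).trans h
  have h2 : -(a + b) ≤ y := neg_le.1 ((neg_le_abs y).trans h)
  refine ⟨(y ⊓ a) ⊔ (-a), y - (y ⊓ a) ⊔ (-a), by abel, ?_, ?_⟩
  · exact abs_le'.2 ⟨sup_le inf_le_right (neg_le_self ha), neg_le.1 le_sup_right⟩
  · refine abs_le'.2 ⟨?_, ?_⟩
    · rw [sub_le_iff_le_add]
      refine le_trans ?_ (add_le_add_right le_sup_left _)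
      rw [add_inf]
      exact le_inf (le_add_of_nonneg_left hb) (by rwa [add_comm])
    · rw [neg_sub, sub_le_iff_le_add]
      refine sup_le (inf_le_left.trans (le_add_of_nonneg_left hb)) ?_
      rw [← sub_le_iff_le_add']
      rwa [sub_eq_add_neg, add_comm, ← sub_eq_add_neg, ← neg_add', add_comm b a]

theorem qSeminorm_add_le (x y : E) : qSeminorm T (x + y) ≤ qSeminorm T x + qSeminorm T y := by
  refine qSeminorm_le T fun w hw => ?_
  obtain ⟨w₁, w₂, rfl, h1, h2⟩ := exists_add_eq_of_abs_le (abs_nonneg x) (abs_nonneg y)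
    (hw.trans (abs_add_le x y))
  rw [map_add]
  exact (norm_add_le _ _).trans (add_le_add (norm_le_qSeminorm T h1) (norm_le_qSeminorm T h2))

theorem qSeminorm_smul_le {c : ℝ} (hc : 0 < c) (x : E) :
    qSeminorm T (c • x) ≤ c * qSeminorm T x := by
  refine qSeminorm_le T fun w hw => ?_
  have h1 : |c⁻¹ • w| ≤ |x| := by
    rw [abs_real_smul] at hw ⊢
    rw [abs_of_pos hc] at hw
    rw [abs_of_pos (inv_pos.2 hc)]
    exact (inv_smul_le_iff_of_pos hc).2 hw
  have h2 := norm_le_qSeminorm T h1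
  rwa [map_smul, norm_smul, Real.norm_of_nonneg (inv_nonneg.2 hc.le), inv_mul_le_iff₀ hc] at h2

theorem qSeminorm_smul {c : ℝ} (hc : 0 ≤ c) (x : E) :
    qSeminorm T (c • x) = c * qSeminorm T x := by
  rcases hc.eq_or_lt with rfl | hc
  · rw [zero_smul, zero_mul]
    refine le_antisymm (qSeminorm_le T fun y hy => ?_) (qSeminorm_nonneg T 0)
    rw [abs_zero] at hy
    have : ‖y‖ ≤ ‖(0 : E)‖ := norm_le_norm_of_abs_le hy
    rw [norm_zero] at this
    rw [norm_le_zero_iff.1 this, map_zero, norm_zero]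
  · refine le_antisymm (qSeminorm_smul_le T hc x) ?_
    have h := qSeminorm_smul_le T (inv_pos.2 hc) (c • x)
    rwa [inv_smul_smul₀ hc.ne', le_inv_mul_iff₀ hc] at h

theorem disjointNull_qSeminorm {p : ℝ} (hE : HasDisjointProperty E p)
    (hT : DisjointPConvergent p T) : DisjointNull (qSeminorm T) where
  mono {x y} hx hxy := qSeminorm_le T fun w hw => norm_le_qSeminorm T (by
    rw [abs_of_nonneg hx] at hw
    exact (hw.trans hxy).trans (le_abs_self y))
  add_le := qSeminorm_add_le T
  smul hc x := qSeminorm_smul T hc x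
  bound := ⟨‖T‖, fun x => qSeminorm_le T fun y hy => T.le_opNorm_of_le (HasSolidNorm.solid hy)⟩
  tendsto_zero d hd := by
    rintro ⟨M, hM⟩ hdisj
    -- Near-maximizers inherit disjointness and boundedness from `d`, so the disjoint property makes
    -- them weakly `p`-summable and `T` sends them to zero in norm.
    have h : ∀ n, ∃ y : E, |y| ≤ |d n| ∧ qSeminorm T (d n) ≤ 2 * ‖T y‖ := by
      intro n
      rcases (qSeminorm_nonneg T (d n)).eq_or_lt with h0 | h0
      · exact ⟨d n, le_rfl, by rw [← h0]; positivity⟩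
      · obtain ⟨_, ⟨y, hy, rfl⟩, hlt⟩ :=
          (lt_isLUB_iff (isLUB_qSeminorm T (d n))).1 (half_lt_self h0)
        exact ⟨y, hy, by linarith⟩
    choose y hy hqy using h
    have hds : DisjointSeq d := fun m n hmn => by
      rw [abs_of_nonneg (hd m), abs_of_nonneg (hd n)]
      rcases hmn.lt_or_gt with h | h
      · exact hdisj m n h
      · rw [inf_comm]; exact hdisj n m h
    have hys := hds.mono hy
    have hlim := (hT y hys (hE y ⟨M, fun n =>
      (HasSolidNorm.solid (hy n)).trans (hM n)⟩ hys)).const_mul 2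
    rw [mul_zero] at hlim
    exact squeeze_zero (fun n => qSeminorm_nonneg T _) hqy hlim

end qSeminorm

/-! ### The equivalence -/

theorem corollary2p9
    {E X : Type*}
    [NormedAddCommGroup E] [NormedSpace ℝ E] [CompleteSpace E]
    [Lattice E] [IsOrderedAddMonoid E] [IsOrderedModule ℝ E] [HasSolidNorm E]
    [NormedAddCommGroup X] [NormedSpace ℝ X] [CompleteSpace X]
    (p : ℝ) (hp : 1 ≤ p)
    (hE : HasCotype (StrongDual ℝ E) p ∨ HasDisjointProperty E p)
    (T : E →L[ℝ] X) :
    List.TFAE [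
      DisjointPConvergent p T,
      ∀ x : ℕ → E, (∀ n, 0 ≤ x n) → WeaklyPSummable p x →
        Tendsto (fun n => ‖T (x n)‖) atTop (𝓝 0),
      ∀ x : ℕ → E, (∀ n, 0 ≤ x n) → WeaklyPSummable p x →
        Tendsto (fun n => qSeminorm T (x n)) atTop (𝓝 0)] := by
  have hE' : HasDisjointProperty E p := hE.elim (fun h => h.hasDisjointProperty) id
  tfae_have 1 → 3 := fun hT x hx hxp =>
    (disjointNull_qSeminorm T hE' hT).tendsto_zero_of_weakly_null hx (hxp.tendsto_zero hp)
  tfae_have 3 → 2 := fun h x hx hxp =>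
    squeeze_zero (fun n => norm_nonneg _) (fun n => norm_le_qSeminorm T le_rfl) (h x hx hxp)
  tfae_have 2 → 1 := fun h x hd hxp => by
    have hpos := h (fun n => (x n)⁺) (fun n => posPart_nonneg _)
      (hxp.of_abs_le hp hd fun n => by
        rw [abs_of_nonneg (posPart_nonneg _), posPart_def]
        exact sup_le (le_abs_self _) (abs_nonneg _))
    have hneg := h (fun n => (x n)⁻) (fun n => negPart_nonneg _)
      (hxp.of_abs_le hp hd fun n => by
        rw [abs_of_nonneg (negPart_nonneg _), negPart_def]
        exact sup_le (neg_le_abs _) (abs_nonneg _))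
    have hadd := hpos.add hneg
    rw [add_zero] at hadd
    refine squeeze_zero (fun n => norm_nonneg _) (fun n => ?_) hadd
    conv_lhs => rw [← posPart_sub_negPart (x n), map_sub]
    exact norm_sub_le _ _
  tfae_finish
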